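/- Let $m,n\ge 1$ be integers. For a real tensor $\mathcal A=(a_{i_1i_2\cdots i_m})_{i_1,\dots,i_m\in\{1,\dots,n\}}$ of order $m$ and dimension $n$ and $x\in\mathbb R^n$, let $\mathcal A x^{m-1}\in\mathbb R^n$ be the vector with entries $$(\mathcal A x^{m-1})_i=\sum_{i_2,\dots,i_m=1}^n a_{i i_2\cdots i_m}x_{i_2}\cdots x_{i_m},\qquad i=1,\dots,n.$$ Let $X\subseteq\mathbb R^n$ be a nonempty closed convex set with $0\in X$, and let $\mathcal A$ be strictly positive definite on $X$, that is, $$(x-y)^\top(\mathcal A x^{m-1}-\mathcal A y^{m-1})>0\quad\text{for all } x,y\in X \text{ with } x\neq y.$$ Then, for every $q\in\mathbb R^n$, the solution set of the tensor variational inequality $\mathrm{TVI}(X,\mathcal A,q)$, namely $$\{x^*\in X:\ \langle y-x^*,\ \mathcal A (x^*)^{m-1}+q\rangle\ge 0\ \text{ for all } y\in X\},$$ is nonempty and compact. -/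

import Mathlib

/-- `𝕋_{m,n}`: real tensors `(a_{i₁ ⋯ iₘ})` of order `m` and dimension `n`. -/
abbrev RealTensor (m n : ℕ) : Type := (Fin m → Fin n) → ℝ

namespace RealTensor

/-- The vector `𝒜x^{m-1}`, for a tensor of order `m ≥ 1`: its `i`-th entry is
`∑_{i₂, …, iₘ} a_{i i₂ ⋯ iₘ} x_{i₂} ⋯ x_{iₘ}`, written as the sum over all multi-indices
`j` whose first entry is `i` (an empty product, which occurs for `m = 1`, is `1`). -/
noncomputable def apply {m n : ℕ} [NeZero m] (A : RealTensor m n)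
    (x : EuclideanSpace ℝ (Fin n)) : EuclideanSpace ℝ (Fin n) :=
  WithLp.toLp 2 fun i =>
    ∑ j : Fin m → Fin n with j 0 = i, A j * ∏ k : Fin m with k ≠ 0, x (j k)

/-- `𝒜` is strictly positive definite on `X`:
`(x - y)ᵀ(𝒜x^{m-1} - 𝒜y^{m-1}) > 0` for all distinct `x, y ∈ X`. -/
def StrictlyPosDefOn {m n : ℕ} [NeZero m] (A : RealTensor m n)
    (X : Set (EuclideanSpace ℝ (Fin n))) : Prop :=
  ∀ x ∈ X, ∀ y ∈ X, x ≠ y → 0 < inner ℝ (x - y) (A.apply x - A.apply y)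

end RealTensor

/-- The solution set of the tensor variational inequality `TVI(X, 𝒜, q)`: the points `x ∈ X`
with `⟨y - x, 𝒜x^{m-1} + q⟩ ≥ 0` for all `y ∈ X`. -/
def tviSolutionSet {m n : ℕ} [NeZero m] (X : Set (EuclideanSpace ℝ (Fin n)))
    (A : RealTensor m n) (q : EuclideanSpace ℝ (Fin n)) : Set (EuclideanSpace ℝ (Fin n)) :=
  {x | x ∈ X ∧ ∀ y ∈ X, 0 ≤ inner ℝ (y - x) (A.apply x + q)}

/-! Strict positive definiteness makes the map x ↦ 𝒜x^{m-1} + q strictly monotone, so solutions are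
unique and compactness is immediate once one exists. For existence, Hahn–Banach separation gives
Minty points for finite families, compactness extends them to X cut by a ball, and Minty's lemma
turns them into solutions there. Homogeneity of degree m-1 makes the map coercive, which keeps the
solution off the bounding sphere, so the ball can be dropped. -/

/-- A finite family of monotone data has a Minty point in the convex hull of its nodes. -/
theorem exists_mem_convexHull_forall_inner_nonneg {E ι : Type*} [NormedAddCommGroup E]
    [InnerProductSpace ℝ E] [Finite ι] [Nonempty ι] (y g : ι → E)
    (hmono : ∀ i j, 0 ≤ inner ℝ (y i - y j) (g i - g j)) :
    ∃ x ∈ convexHull ℝ (Set.range y), ∀ i, 0 ≤ inner ℝ (y i - x) (g i) := by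
  classical
  have := Fintype.ofFinite ι
  by_contra! hcon
  let L : E →ₗ[ℝ] (ι → ℝ) := LinearMap.pi fun i => (innerₗ E) (g i)
  let T : E → ι → ℝ := fun x i => inner ℝ (y i - x) (g i)
  have hT : T = fun x => (fun i => inner ℝ (y i) (g i)) + (-L) x := by
    funext x i
    simp [T, L, inner_sub_left, real_inner_comm (g i), ← sub_eq_add_neg]
  have hTcont : Continuous T := by fun_prop
  have hconv : Convex ℝ (T '' convexHull ℝ (Set.range y)) := by
    have h := ((convex_convexHull ℝ (Set.range y)).linear_image (-L)).translate
      (fun i => inner ℝ (y i) (g i))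
    rwa [Set.image_image, ← hT] at h
  have hcomp : IsCompact (T '' convexHull ℝ (Set.range y)) :=
    ((Set.finite_range y).isCompact_convexHull (𝕜 := ℝ)).image hTcont
  have hdisj : Disjoint (T '' convexHull ℝ (Set.range y)) (Set.Ici 0) := by
    rw [Set.disjoint_left]
    rintro _ ⟨x, hx, rfl⟩ hpos
    obtain ⟨i, hi⟩ := hcon x hx
    exact absurd (hpos i) (not_le.2 hi)
  obtain ⟨f, u, v, hu, huv, hv⟩ :=
    geometric_hahn_banach_compact_closed hconv hcomp (convex_Ici 0) isClosed_Ici hdisj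
  have hv0 : v < 0 := by simpa using hv 0 (Set.mem_Ici.2 le_rfl)
  let μ : ι → ℝ := fun i => f (Pi.single i 1)
  have hf : ∀ w, f w = ∑ i, μ i * w i := fun w => by
    conv_lhs => rw [← Finset.univ_sum_single w]
    rw [map_sum]
    refine Finset.sum_congr rfl fun i _ => ?_
    have : Pi.single i (w i) = w i • (Pi.single i 1 : ι → ℝ) := by
      rw [← Pi.single_smul, smul_eq_mul, mul_one]
    rw [this, map_smul, smul_eq_mul, mul_comm]
  have hμ : ∀ i, 0 ≤ μ i := fun i => by
    by_contra! hi
    -- If `μ i < 0`, this point of the orthant has `f`-value exactly `v`, against `hv`.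
    have hmem : (v / μ i) • (Pi.single i 1 : ι → ℝ) ∈ Set.Ici (0 : ι → ℝ) :=
      Set.mem_Ici.2 <|
        smul_nonneg (div_nonneg_of_nonpos hv0.le hi.le) (Pi.single_nonneg.2 zero_le_one)
    have h := hv _ hmem
    rw [map_smul, smul_eq_mul, div_mul_cancel₀ _ hi.ne] at h
    exact lt_irrefl _ h
  have hneg : ∀ x ∈ convexHull ℝ (Set.range y), ∑ i, μ i * inner ℝ (y i - x) (g i) < 0 :=
    fun x hx => by
      rw [← hf (T x)]
      exact (hu _ ⟨x, hx, rfl⟩).trans (huv.trans hv0)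
  obtain ⟨i₀⟩ := ‹Nonempty ι›
  have hs : 0 < ∑ i, μ i := by
    refine (Finset.sum_nonneg fun i _ => hμ i).lt_of_ne fun h0 => ?_
    have hz := (Finset.sum_eq_zero_iff_of_nonneg fun i _ => hμ i).1 h0.symm
    have h := hneg (y i₀) (subset_convexHull ℝ _ ⟨i₀, rfl⟩)
    rw [Finset.sum_eq_zero fun i hi => by rw [hz i hi, zero_mul]] at h
    exact lt_irrefl _ h
  -- At the `μ`-barycentre the sum is, up to a positive factor, a double sum that symmetrises to
  -- half of ∑ μᵢμⱼ⟨yᵢ - yⱼ, gᵢ - gⱼ⟩ ≥ 0.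
  have hx := hneg _ (Finset.univ.centerMass_mem_convexHull (fun i _ => hμ i) hs
    fun i _ => Set.mem_range_self (f := y) i)
  set x := Finset.univ.centerMass μ y with hxdef
  have hsx : (∑ i, μ i) • x = ∑ i, μ i • y i := by
    rw [hxdef, Finset.centerMass, smul_smul, mul_inv_cancel₀ hs.ne', one_smul]
  have hscale : ∀ i, (∑ j, μ j) * inner ℝ (y i - x) (g i) =
      ∑ j, μ j * inner ℝ (y i - y j) (g i) := fun i => by
    rw [← real_inner_smul_left, smul_sub, hsx, Finset.sum_smul, ← Finset.sum_sub_distrib,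
      sum_inner]
    simp_rw [← smul_sub, real_inner_smul_left]
  have hdouble : (∑ j, μ j) * ∑ i, μ i * inner ℝ (y i - x) (g i) =
      ∑ i, ∑ j, μ i * μ j * inner ℝ (y i - y j) (g i) := by
    rw [Finset.mul_sum]
    refine Finset.sum_congr rfl fun i _ => ?_
    rw [mul_left_comm, hscale, Finset.mul_sum]
    exact Finset.sum_congr rfl fun j _ => (mul_assoc _ _ _).symm
  have hswap : ∑ i, ∑ j, μ i * μ j * inner ℝ (y i - y j) (g i) =
      ∑ i, ∑ j, μ i * μ j * inner ℝ (y j - y i) (g j) := by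
    rw [Finset.sum_comm]
    exact Finset.sum_congr rfl fun i _ => Finset.sum_congr rfl fun j _ => by rw [mul_comm (μ j)]
  have hadd : 0 ≤ ∑ i, ∑ j, μ i * μ j * inner ℝ (y i - y j) (g i) +
      ∑ i, ∑ j, μ i * μ j * inner ℝ (y j - y i) (g j) := by
    simp_rw [← Finset.sum_add_distrib]
    refine Finset.sum_nonneg fun i _ => Finset.sum_nonneg fun j _ => ?_
    have h := mul_nonneg (mul_nonneg (hμ i) (hμ j)) (hmono i j)
    rw [inner_sub_right, mul_sub] at h
    rw [← neg_sub (y i) (y j), inner_neg_left]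
    linarith
  have := mul_neg_of_pos_of_neg hs hx
  linarith

/-- A monotone map on a nonempty compact convex set has a Minty point. -/
theorem IsCompact.exists_forall_inner_nonneg_of_monotone {E : Type*} [NormedAddCommGroup E]
    [InnerProductSpace ℝ E] {K : Set E} (hK : IsCompact K) (hconv : Convex ℝ K)
    (hne : K.Nonempty) {F : E → E}
    (hF : ∀ x ∈ K, ∀ y ∈ K, 0 ≤ inner ℝ (x - y) (F x - F y)) :
    ∃ x ∈ K, ∀ y ∈ K, 0 ≤ inner ℝ (y - x) (F y) := by
  -- Each `y` imposes a closed condition on `x`, so finite subfamilies suffice.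
  obtain ⟨x, hxK, hx⟩ := hK.inter_iInter_nonempty
    (fun y : K => {x : E | 0 ≤ inner ℝ ((y : E) - x) (F y)})
    (fun y => isClosed_le continuous_const (by fun_prop)) fun t => by
      rcases t.eq_empty_or_nonempty with rfl | ht
      · simpa using hne
      have : Nonempty t := ht.to_subtype
      obtain ⟨x, hx, h⟩ := exists_mem_convexHull_forall_inner_nonneg
        (fun i : t => ((i : K) : E)) (fun i : t => F (i : K))
        fun i j => hF _ i.1.2 _ j.1.2
      refine ⟨x, convexHull_min ?_ hconv hx, ?_⟩
      · rintro _ ⟨i, rfl⟩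
        exact i.1.2
      · simp only [Set.mem_iInter]
        exact fun i hi => h ⟨i, hi⟩
  exact ⟨x, hxK, fun y hy => Set.mem_iInter.1 hx ⟨y, hy⟩⟩

/-- **Minty's lemma**: a Minty point of a continuous map on a convex set solves the
variational inequality. -/
theorem Convex.inner_nonneg_of_minty {E : Type*} [NormedAddCommGroup E]
    [InnerProductSpace ℝ E] {K : Set E} (hconv : Convex ℝ K) {F : E → E} (hF : Continuous F)
    {x : E} (hx : x ∈ K) (h : ∀ y ∈ K, 0 ≤ inner ℝ (y - x) (F y)) :
    ∀ y ∈ K, 0 ≤ inner ℝ (y - x) (F x) := by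
  intro y hy
  have hlim : Filter.Tendsto (fun t : ℝ => inner ℝ (y - x) (F (x + t • (y - x))))
      (nhdsWithin 0 (Set.Ioi 0)) (nhds (inner ℝ (y - x) (F x))) := by
    have hc : Continuous fun t : ℝ => inner ℝ (y - x) (F (x + t • (y - x))) := by fun_prop
    simpa using (hc.tendsto 0).mono_left nhdsWithin_le_nhds
  refine ge_of_tendsto hlim ?_
  filter_upwards [Ioc_mem_nhdsGT (zero_lt_one (α := ℝ))] with t ht
  have h1 := h _ (hconv.add_smul_sub_mem hx hy ⟨ht.1.le, ht.2⟩)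
  rw [add_sub_cancel_left, real_inner_smul_left] at h1
  exact nonneg_of_mul_nonneg_right h1 ht.1

/-- A continuous monotone map that is coercive on a closed convex set containing the origin
has a solution of its variational inequality. -/
theorem exists_variationalInequality_of_coercive {E : Type*} [NormedAddCommGroup E]
    [InnerProductSpace ℝ E] [ProperSpace E] {X : Set E} (hclosed : IsClosed X)
    (hconv : Convex ℝ X) (hzero : (0 : E) ∈ X) {F : E → E} (hF : Continuous F)
    (hmono : ∀ x ∈ X, ∀ y ∈ X, 0 ≤ inner ℝ (x - y) (F x - F y)) {R : ℝ} (hR : 0 < R)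
    (hcoer : ∀ x ∈ X, R ≤ ‖x‖ → 0 < inner ℝ x (F x)) :
    ∃ x ∈ X, ∀ y ∈ X, 0 ≤ inner ℝ (y - x) (F x) := by
  have hKconv : Convex ℝ (X ∩ Metric.closedBall 0 R) := hconv.inter (convex_closedBall 0 R)
  have h0 : (0 : E) ∈ X ∩ Metric.closedBall 0 R := ⟨hzero, by simp [hR.le]⟩
  obtain ⟨x, hx, hminty⟩ :=
    ((isCompact_closedBall (0 : E) R).inter_left hclosed).exists_forall_inner_nonneg_of_monotone
      hKconv ⟨0, h0⟩ fun x hx y hy => hmono x hx.1 y hy.1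
  have hvi := hKconv.inner_nonneg_of_minty hF hx hminty
  -- Testing with `y = 0` contradicts coercivity on the sphere. Short steps from `x` towards any
  -- point of `X` thus stay in the ball.
  have hlt : ‖x‖ < R := by
    by_contra! hle
    have h := hvi 0 h0
    rw [zero_sub, inner_neg_left] at h
    linarith [hcoer x hx.1 hle]
  refine ⟨x, hx.1, fun y hy => ?_⟩
  have hlim : Filter.Tendsto (fun t : ℝ => ‖x + t • (y - x)‖)
      (nhdsWithin 0 (Set.Ioi 0)) (nhds ‖x‖) := by
    have hc : Continuous fun t : ℝ => ‖x + t • (y - x)‖ := by fun_prop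
    simpa using (hc.tendsto 0).mono_left nhdsWithin_le_nhds
  obtain ⟨t, htR, ht⟩ := ((hlim.eventually_lt_const hlt).and
    (Ioc_mem_nhdsGT (zero_lt_one (α := ℝ)))).exists
  have h1 := hvi (x + t • (y - x))
    ⟨hconv.add_smul_sub_mem hx.1 hy ⟨ht.1.le, ht.2⟩, by simpa using htR.le⟩
  rw [add_sub_cancel_left, real_inner_smul_left] at h1
  exact nonneg_of_mul_nonneg_right h1 ht.1

namespace RealTensor

variable {m n : ℕ} [NeZero m]

theorem continuous_apply (A : RealTensor m n) : Continuous A.apply := by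
  unfold apply
  fun_prop

theorem apply_smul (A : RealTensor m n) (t : ℝ) (x : EuclideanSpace ℝ (Fin n)) :
    A.apply (t • x) = t ^ (m - 1) • A.apply x := by
  ext i
  simp only [apply, PiLp.smul_apply, smul_eq_mul, Finset.mul_sum, Finset.prod_mul_distrib,
    Finset.prod_const]
  refine Finset.sum_congr rfl fun j _ => ?_
  have hcard : (Finset.univ.filter fun k : Fin m => k ≠ 0).card = m - 1 := by
    rw [Finset.filter_ne', Finset.card_erase_of_mem (Finset.mem_univ _), Finset.card_univ,
      Fintype.card_fin]
  rw [hcard]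
  ring

theorem StrictlyPosDefOn.inner_nonneg {A : RealTensor m n} {X : Set (EuclideanSpace ℝ (Fin n))}
    (hA : A.StrictlyPosDefOn X) {x y : EuclideanSpace ℝ (Fin n)} (hx : x ∈ X) (hy : y ∈ X) :
    0 ≤ inner ℝ (x - y) (A.apply x - A.apply y) := by
  rcases eq_or_ne x y with rfl | hxy
  · simp
  · exact (hA x hx y hy hxy).le

/-- A tensor that is strictly positive definite on a closed convex set containing the origin
is coercive there, also after adding a constant vector. -/
theorem StrictlyPosDefOn.exists_coercive_radius {A : RealTensor m n}
    {X : Set (EuclideanSpace ℝ (Fin n))} (hA : A.StrictlyPosDefOn X) (hclosed : IsClosed X)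
    (hconv : Convex ℝ X) (hzero : (0 : EuclideanSpace ℝ (Fin n)) ∈ X)
    (q : EuclideanSpace ℝ (Fin n)) :
    ∃ R : ℝ, 0 < R ∧ ∀ x ∈ X, R ≤ ‖x‖ → 0 < inner ℝ x (A.apply x + q) := by
  have hpos : ∀ x ∈ X, x ≠ 0 → 0 < inner ℝ x (A.apply x - A.apply 0) := fun x hx hx0 => by
    simpa using hA x hx 0 hzero hx0
  obtain hm | hm : m - 1 = 0 ∨ 1 ≤ m - 1 := by omega
  -- For `m = 1` the map is constant, so strictness forces `X = {0}` and the claim is vacuous.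
  · refine ⟨1, one_pos, fun x hx hx1 => ?_⟩
    have h := hpos x hx (norm_pos_iff.1 (one_pos.trans_le hx1))
    have h0 := A.apply_smul 0 x
    rw [zero_smul, hm, pow_zero, one_smul] at h0
    rw [h0, sub_self, inner_zero_right] at h
    exact absurd h (lt_irrefl _)
  have hA0 : A.apply 0 = 0 := by
    have h0 := A.apply_smul 0 0
    rwa [zero_smul, zero_pow (by omega), zero_smul] at h0
  simp only [hA0, sub_zero] at hpos
  obtain ⟨c, hc, hcle⟩ : ∃ c : ℝ, 0 < c ∧
      ∀ d ∈ X ∩ Metric.sphere 0 1, c ≤ inner ℝ d (A.apply d) := by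
    have hcont := A.continuous_apply
    obtain he | hne := (X ∩ Metric.sphere (0 : EuclideanSpace ℝ (Fin n)) 1).eq_empty_or_nonempty
    · exact ⟨1, one_pos, by simp [he]⟩
    · obtain ⟨d, hd, hmin⟩ := ((isCompact_sphere _ _).inter_left hclosed).exists_isMinOn hne
        (f := fun d => inner ℝ d (A.apply d)) (by fun_prop)
      refine ⟨_, hpos d hd.1 ?_, hmin⟩
      rintro rfl
      simpa using hd.2
  -- The bound `1` puts `x / ‖x‖` in `X` and gives `‖x‖ ≤ ‖x‖ ^ (m - 1)`; the other makes `‖x‖ * c`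
  -- exceed `‖q‖`.
  refine ⟨max 1 ((‖q‖ + 1) / c), by positivity, fun x hx hxR => ?_⟩
  have hx1 : 1 ≤ ‖x‖ := (le_max_left _ _).trans hxR
  have hxc : ‖q‖ + 1 ≤ ‖x‖ * c := (div_le_iff₀ hc).1 ((le_max_right _ _).trans hxR)
  have hx0 : 0 < ‖x‖ := one_pos.trans_le hx1
  set d := ‖x‖⁻¹ • x with hd
  have hxd : x = ‖x‖ • d := by rw [hd, smul_smul, mul_inv_cancel₀ hx0.ne', one_smul]
  have hdX : d ∈ X := hconv.smul_mem_of_zero_mem hzero hx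
    ⟨inv_nonneg.2 hx0.le, inv_le_one_of_one_le₀ hx1⟩
  have hdc := hcle d ⟨hdX, by simp [hd, norm_smul, hx0.ne']⟩
  have hpow : ‖x‖ ≤ ‖x‖ ^ (m - 1) := le_self_pow₀ hx1 (by omega)
  have hmain : ‖x‖ * (‖x‖ * c) ≤ inner ℝ x (A.apply x) := by
    have : inner ℝ x (A.apply x) = ‖x‖ * (‖x‖ ^ (m - 1) * inner ℝ d (A.apply d)) := by
      conv_lhs => rw [hxd]
      rw [apply_smul, real_inner_smul_left, real_inner_smul_right]
    rw [this]
    gcongr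
  have hq := neg_le_of_abs_le (abs_real_inner_le_norm x q)
  rw [inner_add_right]
  nlinarith

end RealTensor

theorem tviSolutionSet_subsingleton {m n : ℕ} [NeZero m] {X : Set (EuclideanSpace ℝ (Fin n))}
    {A : RealTensor m n} (hA : A.StrictlyPosDefOn X) (q : EuclideanSpace ℝ (Fin n)) :
    (tviSolutionSet X A q).Subsingleton := by
  rintro x ⟨hx, hxs⟩ y ⟨hy, hys⟩
  by_contra hxy
  have h := hA x hx y hy hxy
  have h1 := hxs y hy
  have h2 := hys x hx
  rw [← neg_sub x y, inner_neg_left, inner_add_right] at h1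
  rw [inner_add_right] at h2
  rw [inner_sub_right] at h
  linarith

theorem corollary4p1 {m n : ℕ} [NeZero m] (X : Set (EuclideanSpace ℝ (Fin n)))
    (hne : X.Nonempty) (hclosed : IsClosed X) (hconvex : Convex ℝ X)
    (hzero : (0 : EuclideanSpace ℝ (Fin n)) ∈ X)
    (A : RealTensor m n) (hA : A.StrictlyPosDefOn X) (q : EuclideanSpace ℝ (Fin n)) :
    (tviSolutionSet X A q).Nonempty ∧ IsCompact (tviSolutionSet X A q) := by
  refine ⟨?_, (tviSolutionSet_subsingleton hA q).isCompact⟩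
  obtain ⟨R, hR, hcoer⟩ := hA.exists_coercive_radius hclosed hconvex hzero q
  exact exists_variationalInequality_of_coercive hclosed hconvex hzero
    (F := fun x => A.apply x + q) (A.continuous_apply.add continuous_const)
    (fun x hx y hy => by simpa using hA.inner_nonneg hx hy) hR hcoer
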